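/- A subset $A$ of a group is called product-free if there are no elements $x,y,z\in A$ (not necessarily distinct) with $xy=z$. For every real constant $c>0$, there are, up to isomorphism, only finitely many finite simple non-abelian groups $G$ containing a product-free set of size at least $c|G|$. Consequently, the question of Babai and Sós, whether there exists a constant $c>0$ such that every (non-trivial) finite group $G$ contains a product-free set of size at least $c|G|$, has a negative answer, even when restricted to finite simple non-abelian groups: there is no $c>0$ such that every finite simple non-abelian group $G$ contains a product-free set of size at least $c|G|$, and hence no $c>0$ such that every non-trivial finite group $G$ does. -/

import Mathlib

universe u

/-- A subset of a group is product-free if it contains no elements `x`, `y`, `z`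
(not necessarily distinct) with `x * y = z`. -/
def IsProductFree {G : Type u} [Group G] (A : Set G) : Prop :=
  ∀ x ∈ A, ∀ y ∈ A, ∀ z ∈ A, x * y ≠ z

/-- `G` contains a product-free set of size at least `c * |G|` (meant for finite `G`). -/
def HasLargeProductFree (c : ℝ) (G : Type u) [Group G] : Prop :=
  ∃ A : Set G, IsProductFree A ∧ c * (Nat.card G : ℝ) ≤ (A.ncard : ℝ)

/-- `G` is a finite simple non-abelian group. -/
def IsFiniteSimpleNonabelian (G : Type u) [Group G] : Prop :=
  Finite G ∧ IsSimpleGroup G ∧ ∃ a b : G, a * b ≠ b * a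

/-- The isomorphism class of a group. -/
def groupIsoClass (G : GrpCat.{u}) : Quotient (CategoryTheory.isIsomorphicSetoid GrpCat.{u}) :=
  Quotient.mk (CategoryTheory.isIsomorphicSetoid GrpCat.{u}) G

/-! A dense product-free set forces a nontrivial representation of bounded dimension, and a
nonabelian simple group with such a representation has bounded order. Let `a = |A|`, `n = |G|`, let
`f` be the balanced indicator of `A`, and let `T` be left convolution by `f`. Product-freeness makes
`⟪T 1_A, 1_A⟫ = -a³/n`, so the top eigenvalue of `T* T` is at least `a⁴/n²`, while its trace is at
most `n a`. The eigenspace thus has dimension at most `(n/a)³ ≤ c⁻³`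
(`IsProductFree.exists_small_eigenspace`). Right translations commute with `T* T` and act faithfully
there, and a packing argument bounds `|G|` (`card_le_of_injective_contractive`). Large alternating
groups then refute the existence of a uniform `c`. -/

/-! ### Separation and packing for simple linear groups. -/

/-- Commutators of elements near `1` are nearer still, so a nontrivial `m` closest to `1`, if within
`1/2`, commutes with all its conjugates. These generate `G`, so `m` is central and `G` abelian. -/
theorem half_le_norm_map_sub_one {R G : Type*} [NormedRing R] [Group G] [Finite G] [IsSimpleGroup G]
    (hG : ∃ a b : G, a * b ≠ b * a) (φ : G →* R) (hφ : Function.Injective φ)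
    (hn : ∀ g, ‖φ g‖ ≤ 1) {g : G} (hg : g ≠ 1) : 1 / 2 ≤ ‖φ g - 1‖ := by
  by_contra! hlt
  obtain ⟨m, hm1, hmin⟩ := Set.exists_min_image {g : G | g ≠ 1} (fun g => ‖φ g - 1‖)
    (Set.toFinite _) ⟨g, hg⟩
  have hm1 : m ≠ 1 := hm1
  have hm : ‖φ m - 1‖ < 1 / 2 := (hmin g hg).trans_lt hlt
  have hinv : ∀ k : G, φ k * φ k⁻¹ = 1 := fun k => by rw [← map_mul, mul_inv_cancel, map_one]
  have conj_le : ∀ k x : G, ‖φ (k * x * k⁻¹) - 1‖ ≤ ‖φ x - 1‖ := by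
    intro k x
    have : φ (k * x * k⁻¹) - 1 = φ k * (φ x - 1) * φ k⁻¹ := by
      rw [mul_sub, sub_mul, mul_one, hinv, map_mul, map_mul]
    rw [this]
    calc _ ≤ ‖φ k‖ * ‖φ x - 1‖ * ‖φ k⁻¹‖ := norm_mul₃_le
      _ ≤ 1 * ‖φ x - 1‖ * 1 := by gcongr <;> apply hn
      _ = _ := by ring
  have comm_le : ∀ x y : G, ‖φ (x * y * x⁻¹ * y⁻¹) - 1‖ ≤ 2 * ‖φ x - 1‖ * ‖φ y - 1‖ := by
    intro x y
    have : φ (x * y * x⁻¹ * y⁻¹) - 1 =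
        ((φ x - 1) * (φ y - 1) - (φ y - 1) * (φ x - 1)) * φ (x⁻¹ * y⁻¹) := by
      have h1 : (φ x - 1) * (φ y - 1) - (φ y - 1) * (φ x - 1) = φ (x * y) - φ (y * x) := by
        rw [map_mul, map_mul]; noncomm_ring
      rw [h1, sub_mul, ← map_mul, ← map_mul, ← map_one φ]
      congr 2 <;> group
    rw [this]
    calc _ ≤ ‖(φ x - 1) * (φ y - 1) - (φ y - 1) * (φ x - 1)‖ * ‖φ (x⁻¹ * y⁻¹)‖ := norm_mul_le _ _
      _ ≤ (‖φ x - 1‖ * ‖φ y - 1‖ + ‖φ y - 1‖ * ‖φ x - 1‖) * 1 := by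
        gcongr
        · exact (norm_sub_le _ _).trans (add_le_add (norm_mul_le _ _) (norm_mul_le _ _))
        · apply hn
      _ = _ := by ring
  have hpos : 0 < ‖φ m - 1‖ := by
    rw [norm_pos_iff, sub_ne_zero, ← map_one φ]
    exact fun h => hm1 (hφ h)
  have key : ∀ k : G, m * (k * m * k⁻¹) = (k * m * k⁻¹) * m := by
    intro k
    by_contra hne
    have hne' : m * (k * m * k⁻¹) * m⁻¹ * (k * m * k⁻¹)⁻¹ ≠ 1 := by
      intro h
      rw [mul_inv_eq_one, mul_inv_eq_iff_eq_mul] at h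
      exact hne h
    have h1 := hmin _ hne'
    have h2 := comm_le m (k * m * k⁻¹)
    have h3 := conj_le k m
    nlinarith
  have hcen : Subgroup.normalClosure {m} = ⊤ := by
    refine (Subgroup.normalClosure_normal.eq_bot_or_eq_top).resolve_left fun h => hm1 ?_
    rw [Subgroup.normalClosure_eq_bot_iff] at h
    simpa using h
  have hmc : m ∈ Subgroup.center G := by
    have hle : Subgroup.normalClosure {m} ≤ Subgroup.centralizer {m} := by
      rw [Subgroup.normalClosure, Subgroup.closure_le]
      intro x hx
      obtain ⟨a, ha, hax⟩ := Group.mem_conjugatesOfSet_iff.1 hx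
      obtain rfl : a = m := ha
      obtain ⟨k, rfl⟩ := isConj_iff.1 hax
      rw [SetLike.mem_coe, Subgroup.mem_centralizer_singleton_iff]
      exact (key k).symm
    rw [hcen] at hle
    rw [Subgroup.mem_center_iff]
    intro x
    exact Subgroup.mem_centralizer_singleton_iff.1 (hle (Subgroup.mem_top x))
  have htop : Subgroup.center G = ⊤ := by
    refine (Subgroup.Normal.eq_bot_or_eq_top inferInstance).resolve_left fun h => hm1 ?_
    rwa [h, Subgroup.mem_bot] at hmc
  obtain ⟨a, b, hab⟩ := hG
  have ha : a ∈ Subgroup.center G := htop ▸ Subgroup.mem_top a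
  exact hab (Subgroup.mem_center_iff.1 ha b).symm

theorem card_le_of_injective_contractive {R G : Type*} [NormedRing R] [NormedAlgebra ℝ R]
    [FiniteDimensional ℝ R] [Group G] [Finite G] [IsSimpleGroup G]
    (hG : ∃ a b : G, a * b ≠ b * a) (φ : G →* R) (hφ : Function.Injective φ)
    (hn : ∀ g, ‖φ g‖ ≤ 1) : Nat.card G ≤ 5 ^ Module.finrank ℝ R := by
  classical
  have := Fintype.ofFinite G
  -- Doubling turns `1/2`-separation in the unit ball into `1`-separation in the ball of radius `2`,
  -- as the packing bound requires.
  have hinj : Function.Injective fun g => (2 : ℝ) • φ g :=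
    (smul_right_injective R (two_ne_zero (α := ℝ))).comp hφ
  have h := Besicovitch.card_le_of_separated (Finset.univ.image fun g => (2 : ℝ) • φ g) ?_ ?_
  · rwa [Finset.card_image_of_injective _ hinj, Finset.card_univ, ← Nat.card_eq_fintype_card] at h
  · simp only [Finset.mem_image, Finset.mem_univ, true_and, forall_exists_index,
      forall_apply_eq_imp_iff]
    intro g
    rw [norm_smul, Real.norm_two]
    linarith [hn g]
  · simp only [Finset.mem_image, Finset.mem_univ, true_and, forall_exists_index,
      forall_apply_eq_imp_iff]
    intro g k hne
    have hgk : k⁻¹ * g ≠ 1 := fun h => hne (by rw [inv_mul_eq_one.1 h])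
    have h1 := half_le_norm_map_sub_one hG φ hφ hn hgk
    have h2 : φ (k⁻¹ * g) - 1 = φ k⁻¹ * (φ g - φ k) := by
      rw [mul_sub, ← map_mul, ← map_mul, inv_mul_cancel, map_one]
    have h3 : ‖φ (k⁻¹ * g) - 1‖ ≤ ‖φ g - φ k‖ := by
      rw [h2]
      refine (norm_mul_le _ _).trans ?_
      exact mul_le_of_le_one_left (norm_nonneg _) (hn _)
    rw [← smul_sub, norm_smul, Real.norm_two]
    linarith

/-! ### Convolution operators and their eigenspaces. -/

open scoped InnerProductSpace

theorem LinearMap.IsSymmetric.exists_hasEigenvalue_inner_le {E : Type*} [NormedAddCommGroup E]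
    [InnerProductSpace ℝ E] [FiniteDimensional ℝ E] {S : E →ₗ[ℝ] E} (hS : S.IsSymmetric)
    {v : E} (hv : v ≠ 0) :
    ∃ μ : ℝ, Module.End.HasEigenvalue S μ ∧ ⟪S v, v⟫_ℝ ≤ μ * ‖v‖ ^ 2 := by
  have : Nontrivial E := ⟨v, 0, hv⟩
  refine ⟨_, hS.hasEigenvalue_iSup_of_finiteDimensional, ?_⟩
  have hv' : 0 < ‖v‖ ^ 2 := by positivity
  rw [← div_le_iff₀ hv']
  refine le_ciSup (f := fun x : {x : E // x ≠ 0} => RCLike.re ⟪S x, x⟫_ℝ / ‖(x : E)‖ ^ 2) ?_ ⟨v, hv⟩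
  refine ⟨‖S.toContinuousLinearMap‖, ?_⟩
  rintro _ ⟨⟨x, hx⟩, rfl⟩
  have hx' : 0 < ‖x‖ ^ 2 := by positivity
  refine (div_le_iff₀ hx').2 ?_
  have h1 : ⟪S x, x⟫_ℝ ≤ ‖S x‖ * ‖x‖ := real_inner_le_norm _ _
  have h2 : ‖S x‖ ≤ ‖S.toContinuousLinearMap‖ * ‖x‖ := S.toContinuousLinearMap.le_opNorm x
  have h3 : ‖S x‖ * ‖x‖ ≤ ‖S.toContinuousLinearMap‖ * ‖x‖ * ‖x‖ := by gcongr
  simp only [RCLike.re_to_real]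
  linarith

section Convolution

variable {G : Type*} [Group G] [Fintype G]

/-- The vector `x ↦ f (y * x⁻¹)`, the row at `y` of the matrix of left convolution by `f`. -/
noncomputable def leftConvRow (f : G → ℝ) (y : G) : EuclideanSpace ℝ G :=
  WithLp.toLp 2 fun x => f (y * x⁻¹)

/-- Left convolution by `f`, sending `v` to `y ↦ ∑ x, f (y * x⁻¹) * v x`. -/
noncomputable def leftConv (f : G → ℝ) : EuclideanSpace ℝ G →ₗ[ℝ] EuclideanSpace ℝ G where
  toFun v := WithLp.toLp 2 fun y => ⟪leftConvRow f y, v⟫_ℝ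
  map_add' v w := by ext y; simp [inner_add_right]
  map_smul' a v := by ext y; simp [inner_smul_right]

theorem leftConv_apply (f : G → ℝ) (v : EuclideanSpace ℝ G) (y : G) :
    leftConv f v y = ⟪leftConvRow f y, v⟫_ℝ := rfl

theorem leftConv_apply_eq_sum (f : G → ℝ) (v : EuclideanSpace ℝ G) (y : G) :
    leftConv f v y = ∑ x, f (y * x⁻¹) * v x := by
  simp [leftConv_apply, leftConvRow, PiLp.inner_apply, mul_comm]

theorem sum_apply_mul_inv (f : G → ℝ) (y : G) : ∑ x, f (y * x⁻¹) = ∑ x, f x :=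
  Fintype.sum_equiv ((Equiv.inv G).trans (Equiv.mulLeft y)) _ _ fun _ => rfl

theorem norm_leftConvRow_sq (f : G → ℝ) (y : G) : ‖leftConvRow f y‖ ^ 2 = ∑ x, f x ^ 2 := by
  rw [EuclideanSpace.norm_sq_eq, ← sum_apply_mul_inv (fun x => f x ^ 2) y]
  simp [leftConvRow]

/-- Right translation, sending `v` to `x ↦ v (x * g)`. -/
noncomputable def rightTranslation (g : G) : EuclideanSpace ℝ G ≃ₗᵢ[ℝ] EuclideanSpace ℝ G :=
  LinearIsometryEquiv.piLpCongrLeft 2 ℝ ℝ (Equiv.mulRight g⁻¹)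

@[simp]
theorem rightTranslation_apply (g : G) (v : EuclideanSpace ℝ G) (x : G) :
    rightTranslation g v x = v (x * g) := by
  simp [rightTranslation, LinearIsometryEquiv.piLpCongrLeft_apply, Equiv.piCongrLeft']

theorem leftConv_rightTranslation (f : G → ℝ) (g : G) (v : EuclideanSpace ℝ G) :
    leftConv f (rightTranslation g v) = rightTranslation g (leftConv f v) := by
  ext y
  rw [rightTranslation_apply, leftConv_apply_eq_sum, leftConv_apply_eq_sum]
  exact Fintype.sum_equiv (Equiv.mulRight g) _ _ fun x => by simp [mul_assoc]

/-- The positive operator `T* T` for `T` the left convolution by `f`. -/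
noncomputable def leftConvSq (f : G → ℝ) : EuclideanSpace ℝ G →ₗ[ℝ] EuclideanSpace ℝ G :=
  (leftConv f).adjoint ∘ₗ leftConv f

theorem inner_leftConvSq (f : G → ℝ) (v w : EuclideanSpace ℝ G) :
    ⟪leftConvSq f v, w⟫_ℝ = ⟪leftConv f v, leftConv f w⟫_ℝ := by
  rw [leftConvSq, LinearMap.comp_apply, LinearMap.adjoint_inner_left]

theorem isSymmetric_leftConvSq (f : G → ℝ) : (leftConvSq f).IsSymmetric := fun v w => by
  rw [inner_leftConvSq, real_inner_comm, ← inner_leftConvSq, real_inner_comm]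

theorem leftConvSq_rightTranslation (f : G → ℝ) (g : G) (v : EuclideanSpace ℝ G) :
    leftConvSq f (rightTranslation g v) = rightTranslation g (leftConvSq f v) := by
  refine ext_inner_right ℝ fun w => ?_
  obtain ⟨w, rfl⟩ := (rightTranslation g).surjective w
  rw [inner_leftConvSq, leftConv_rightTranslation, leftConv_rightTranslation,
    LinearIsometryEquiv.inner_map_map, LinearIsometryEquiv.inner_map_map, inner_leftConvSq]

/-- A trace bound: apply Bessel's inequality to each row of the convolution matrix, using an
orthonormal basis of the eigenspace. -/
theorem finrank_eigenspace_leftConvSq_mul_le (f : G → ℝ) (μ : ℝ) :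
    Module.finrank ℝ (Module.End.eigenspace (leftConvSq f) μ) * μ ≤
      Nat.card G * ∑ x, f x ^ 2 := by
  set E := Module.End.eigenspace (leftConvSq f) μ
  let b := stdOrthonormalBasis ℝ E
  have hb : Orthonormal ℝ fun i => (b i : EuclideanSpace ℝ G) :=
    b.orthonormal.comp_linearIsometry E.subtypeₗᵢ
  have h1 : ∀ i, ∑ y, ⟪(b i : EuclideanSpace ℝ G), leftConvRow f y⟫_ℝ ^ 2 = μ := by
    intro i
    have h : ‖leftConv f (b i)‖ ^ 2 = μ := by
      rw [← real_inner_self_eq_norm_sq, ← inner_leftConvSq,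
        Module.End.mem_eigenspace_iff.1 (b i).2, inner_smul_left, real_inner_self_eq_norm_sq,
        hb.1 i]
      simp
    rw [← h, EuclideanSpace.norm_sq_eq]
    simp [leftConv_apply, real_inner_comm]
  calc Module.finrank ℝ E * μ
      = ∑ i, ∑ y, ⟪(b i : EuclideanSpace ℝ G), leftConvRow f y⟫_ℝ ^ 2 := by simp [h1]
    _ = ∑ y, ∑ i, ‖⟪(b i : EuclideanSpace ℝ G), leftConvRow f y⟫_ℝ‖ ^ 2 := by
      rw [Finset.sum_comm]; simp
    _ ≤ ∑ y : G, ‖leftConvRow f y‖ ^ 2 :=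
      Finset.sum_le_sum fun y _ => hb.sum_inner_products_le _
    _ = _ := by simp [norm_leftConvRow_sq]

/-- Right translation on an eigenspace of `leftConvSq f`. -/
noncomputable def eigenspaceTranslation (f : G → ℝ) (μ : ℝ) :
    G →* (Module.End.eigenspace (leftConvSq f) μ →L[ℝ]
      Module.End.eigenspace (leftConvSq f) μ) where
  toFun g := ((rightTranslation g).toContinuousLinearEquiv.toContinuousLinearMap.comp
      (Module.End.eigenspace (leftConvSq f) μ).subtypeL).codRestrict _ fun v => by
    rw [Module.End.mem_eigenspace_iff]
    simp [leftConvSq_rightTranslation, Module.End.mem_eigenspace_iff.1 v.2]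
  map_one' := by ext v x; simp
  map_mul' g h := by ext v x; simp [mul_assoc]

@[simp]
theorem coe_eigenspaceTranslation_apply (f : G → ℝ) (μ : ℝ) (g : G)
    (v : Module.End.eigenspace (leftConvSq f) μ) :
    (eigenspaceTranslation f μ g v : EuclideanSpace ℝ G) = rightTranslation g v := rfl

theorem norm_eigenspaceTranslation_le (f : G → ℝ) (μ : ℝ) (g : G) :
    ‖eigenspaceTranslation f μ g‖ ≤ 1 := by
  refine ContinuousLinearMap.opNorm_le_bound _ zero_le_one fun v => ?_
  rw [one_mul]
  exact ((rightTranslation g).norm_map (v : EuclideanSpace ℝ G)).le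

/-- By simplicity the action is otherwise trivial; eigenvectors are then constant functions, which a
mean-zero `f` annihilates. -/
theorem eigenspaceTranslation_injective [IsSimpleGroup G] {f : G → ℝ} (hf : ∑ x, f x = 0) {μ : ℝ}
    (hμ : Module.End.HasEigenvalue (leftConvSq f) μ) (hμ0 : μ ≠ 0) :
    Function.Injective (eigenspaceTranslation f μ) := by
  rw [← MonoidHom.ker_eq_bot_iff]
  refine (Subgroup.Normal.eq_bot_or_eq_top inferInstance).resolve_right fun htop => ?_
  obtain ⟨v, hv⟩ := hμ.exists_hasEigenvector
  have hconst : ∀ g, v g = v 1 := by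
    intro g
    have hg : g ∈ (eigenspaceTranslation f μ).ker := htop ▸ Subgroup.mem_top g
    have h := congrArg (fun w : EuclideanSpace ℝ G => w 1) (congrArg Subtype.val
      (DFunLike.congr_fun (MonoidHom.mem_ker.1 hg) (⟨v, hv.1⟩ : Module.End.eigenspace _ μ)))
    simpa using h
  have h0 : leftConv f v = 0 := by
    ext y
    rw [leftConv_apply_eq_sum]
    simp_rw [hconst]
    rw [← Finset.sum_mul, sum_apply_mul_inv, hf]
    simp
  have h1 : μ • v = 0 := by
    rw [← hv.apply_eq_smul, leftConvSq, LinearMap.comp_apply, h0, map_zero]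
  exact (smul_eq_zero.1 h1).elim hμ0 hv.2

end Convolution

/-! ### From product-free sets to a bound on the order. -/

theorem IsProductFree.exists_small_eigenspace {G : Type*} [Group G] [Fintype G] {A : Set G}
    (hA : IsProductFree A) (hne : A.Nonempty) :
    ∃ (f : G → ℝ) (μ : ℝ), ∑ x, f x = 0 ∧ 0 < μ ∧
      Module.End.HasEigenvalue (leftConvSq f) μ ∧
      Module.finrank ℝ (Module.End.eigenspace (leftConvSq f) μ) * (A.ncard : ℝ) ^ 3 ≤
        (Nat.card G : ℝ) ^ 3 := by
  classical
  have hG : 0 < (Nat.card G : ℝ) := by exact_mod_cast Nat.card_pos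
  have ha : 0 < (A.ncard : ℝ) := by exact_mod_cast (Set.ncard_pos (Set.toFinite A)).2 hne
  have hsum : ∑ x, A.indicator (1 : G → ℝ) x = A.ncard := by
    simp [Set.indicator_apply, Set.ncard_eq_toFinset_card']
  have hcard : (Fintype.card G : ℝ) = Nat.card G := by simp
  have hsq : ∀ x, A.indicator (1 : G → ℝ) x ^ 2 = A.indicator 1 x := fun x => by
    by_cases hx : x ∈ A <;> simp [hx]
  set n : ℝ := (Nat.card G : ℝ)
  set a : ℝ := (A.ncard : ℝ)
  set f : G → ℝ := fun x => A.indicator 1 x - a / n with hf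
  set v : EuclideanSpace ℝ G := WithLp.toLp 2 (A.indicator 1) with hv
  have hvx : ∀ x, v x = A.indicator 1 x := fun _ => rfl
  have hv2 : ‖v‖ ^ 2 = a := by
    rw [EuclideanSpace.norm_sq_eq, ← hsum]
    exact Finset.sum_congr rfl fun x _ => by rw [Real.norm_eq_abs, sq_abs, hvx, hsq]
  have hv0 : v ≠ 0 := fun h => by rw [h] at hv2; simp at hv2; exact ha.ne hv2
  have hf0 : ∑ x, f x = 0 := by
    rw [hf, Finset.sum_sub_distrib, hsum, Finset.sum_const, Finset.card_univ, nsmul_eq_mul, hcard]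
    field_simp
    ring
  have hf2 : ∑ x, f x ^ 2 ≤ a := by
    have : ∀ x, f x ^ 2 = A.indicator 1 x - a / n * A.indicator 1 x - a / n * f x := fun x => by
      have := hsq x
      simp only [hf]
      linear_combination this
    simp_rw [this]
    rw [Finset.sum_sub_distrib, Finset.sum_sub_distrib, ← Finset.mul_sum, ← Finset.mul_sum, hf0,
      hsum]
    have : 0 ≤ a / n * a := by positivity
    linarith
  have hTv : ⟪leftConv f v, v⟫_ℝ = -(a / n * a ^ 2) := by
    have h1 : ∀ y, leftConv f v y * v y = -(a / n * a) * A.indicator 1 y := by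
      intro y
      by_cases hy : y ∈ A
      · rw [leftConv_apply_eq_sum, hvx, Set.indicator_of_mem hy, Pi.one_apply, mul_one, mul_one,
          neg_mul_eq_mul_neg, ← hsum, ← Finset.sum_neg_distrib, Finset.mul_sum]
        refine Finset.sum_congr rfl fun x _ => ?_
        by_cases hx : x ∈ A
        -- The only use of product-freeness: `f (y * x⁻¹)` is exactly `-a / n` for `x, y ∈ A`.
        · have hyx : y * x⁻¹ ∉ A := fun h => hA _ h x hx y hy (by simp)
          simp [hf, hvx, hx, hyx, hsum]
        · simp [hvx, hx]
      · simp [hvx, hy]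
    have h2 : ⟪leftConv f v, v⟫_ℝ = ∑ y, leftConv f v y * v y := by
      simp [PiLp.inner_apply, mul_comm]
    rw [h2, Finset.sum_congr rfl fun y _ => h1 y, ← Finset.mul_sum, hsum]
    ring
  obtain ⟨μ, hμ, hle⟩ := (isSymmetric_leftConvSq f).exists_hasEigenvalue_inner_le hv0
  rw [inner_leftConvSq, real_inner_self_eq_norm_sq, hv2] at hle
  have hcs : (a / n * a ^ 2) ^ 2 ≤ ‖leftConv f v‖ ^ 2 * a := by
    have h := abs_real_inner_le_norm (leftConv f v) v
    rw [hTv, abs_neg, abs_of_pos (by positivity)] at h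
    rw [← hv2, ← mul_pow, hv2]
    gcongr
  have hμ1 : a ^ 4 / n ^ 2 ≤ μ := by
    have h : a ^ 4 / n ^ 2 * a ^ 2 ≤ μ * a ^ 2 := by
      calc _ = (a / n * a ^ 2) ^ 2 := by ring
        _ ≤ ‖leftConv f v‖ ^ 2 * a := hcs
        _ ≤ μ * a * a := by gcongr
        _ = _ := by ring
    exact le_of_mul_le_mul_right h (by positivity)
  refine ⟨f, μ, hf0, lt_of_lt_of_le (by positivity) hμ1, hμ, ?_⟩
  have hd := finrank_eigenspace_leftConvSq_mul_le f μ
  set d : ℝ := (Module.finrank ℝ (Module.End.eigenspace (leftConvSq f) μ) : ℝ)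
  have hd0 : 0 ≤ d := Nat.cast_nonneg _
  have h : d * (a ^ 4 / n ^ 2) ≤ n * a :=
    calc _ ≤ d * μ := by gcongr
      _ ≤ _ := hd
      _ ≤ _ := by gcongr
  have h' : d * a ^ 3 * (a / n ^ 2) ≤ n ^ 3 * (a / n ^ 2) := by
    calc _ = d * (a ^ 4 / n ^ 2) := by ring
      _ ≤ n * a := h
      _ = _ := by field_simp
  exact le_of_mul_le_mul_right h' (by positivity)

theorem exists_card_bound_of_hasLargeProductFree {c : ℝ} (hc : 0 < c) :
    ∃ N : ℕ, ∀ (G : Type*) [Group G], IsFiniteSimpleNonabelian G → HasLargeProductFree c G →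
      Nat.card G ≤ N := by
  -- The exponent bounds the dimension of the endomorphism algebra, the square of that of the
  -- eigenspace.
  refine ⟨5 ^ (⌊(c ^ 3)⁻¹⌋₊ * ⌊(c ^ 3)⁻¹⌋₊), fun G _ ⟨_, _, hG⟩ ⟨A, hA, hcA⟩ => ?_⟩
  have := Fintype.ofFinite G
  have hG0 : 0 < (Nat.card G : ℝ) := by exact_mod_cast Nat.card_pos
  have hne : A.Nonempty := by
    rw [Set.nonempty_iff_ne_empty]
    rintro rfl
    rw [Set.ncard_empty, Nat.cast_zero] at hcA
    exact hcA.not_gt (by positivity)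
  obtain ⟨f, μ, hf, hμ0, hμ, hd⟩ := hA.exists_small_eigenspace hne
  have hcard := card_le_of_injective_contractive
    (R := Module.End.eigenspace (leftConvSq f) μ →L[ℝ] Module.End.eigenspace (leftConvSq f) μ)
    hG (eigenspaceTranslation f μ)
    (eigenspaceTranslation_injective hf hμ hμ0.ne') (norm_eigenspaceTranslation_le f μ)
  have hfin : Module.finrank ℝ (Module.End.eigenspace (leftConvSq f) μ) ≤ ⌊(c ^ 3)⁻¹⌋₊ := by
    refine Nat.le_floor ?_
    rw [← one_div, le_div_iff₀ (by positivity)]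
    refine le_of_mul_le_mul_right ?_ (pow_pos hG0 3)
    rw [one_mul, mul_assoc, ← mul_pow]
    refine le_trans ?_ hd
    gcongr
  refine hcard.trans (Nat.pow_le_pow_right (by norm_num) ?_)
  rw [← (LinearMap.toContinuousLinearMap (𝕜 := ℝ)).finrank_eq, Module.finrank_linearMap]
  exact Nat.mul_le_mul hfin hfin

/-! ### Counting isomorphism classes, and the alternating groups. -/

/-- Each such group transports to a group structure on a fixed `n`-element type, and there are
finitely many multiplication tables. -/
theorem finite_groupIsoClass_image_of_card_le (N : ℕ) :
    (groupIsoClass.{u} '' {G : GrpCat.{u} | Finite G ∧ Nat.card G ≤ N}).Finite := by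
  have hfin : ∀ n, Finite (Group (ULift.{u} (Fin n))) := fun n =>
    Finite.of_injective (fun g : Group (ULift.{u} (Fin n)) => g.mul) fun _ _ h => Group.ext h
  refine Set.Finite.subset (Set.Finite.biUnion (Set.finite_Iic N) fun n _ => Set.finite_range
    fun g : Group (ULift.{u} (Fin n)) => groupIsoClass (@GrpCat.of _ g)) ?_
  rintro _ ⟨G, ⟨hG, hN⟩, rfl⟩
  let e : ULift.{u} (Fin (Nat.card G)) ≃ G := Equiv.ulift.trans (Finite.equivFin G).symm
  simp only [Set.mem_iUnion]
  exact ⟨Nat.card G, hN, e.group, Quotient.sound ⟨(@Equiv.mulEquiv _ _ e _).toGrpIso⟩⟩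

theorem isFiniteSimpleNonabelian_alternatingGroup {α : Type*} [Fintype α] [DecidableEq α]
    (hα : 5 ≤ Nat.card α) : IsFiniteSimpleNonabelian (alternatingGroup α) := by
  refine ⟨inferInstance, alternatingGroup.isSimpleGroup hα, ?_⟩
  by_contra! h
  have : IsMulCommutative (alternatingGroup α) := ⟨⟨h⟩⟩
  have := alternatingGroup.isMulCommutative_iff_card_le_three.1 this
  omega

theorem exists_isFiniteSimpleNonabelian_card_gt (N : ℕ) :
    ∃ (G : Type u) (_ : Group G), IsFiniteSimpleNonabelian G ∧ N < Nat.card G := by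
  have hcard : Nat.card (ULift.{u} (Fin (N + 5))) = N + 5 := by simp
  refine ⟨alternatingGroup (ULift.{u} (Fin (N + 5))), inferInstance,
    isFiniteSimpleNonabelian_alternatingGroup (by omega), ?_⟩
  have : Nontrivial (ULift.{u} (Fin (N + 5))) := Equiv.ulift.nontrivial
  have h := two_mul_nat_card_alternatingGroup (α := ULift.{u} (Fin (N + 5)))
  rw [Nat.card_perm, hcard, Nat.factorial_succ] at h
  have h1 : N + 4 ≤ (N + 4).factorial := Nat.self_le_factorial _
  nlinarith

theorem mainTheorem7 :
    (∀ c : ℝ, 0 < c →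
      (groupIsoClass.{u} ''
        {G : GrpCat.{u} | IsFiniteSimpleNonabelian G ∧ HasLargeProductFree c G}).Finite) ∧
    (¬ ∃ c : ℝ, 0 < c ∧ ∀ (G : Type u) [Group G],
      IsFiniteSimpleNonabelian G → HasLargeProductFree c G) ∧
    (¬ ∃ c : ℝ, 0 < c ∧ ∀ (G : Type u) [Group G] [Finite G] [Nontrivial G],
      HasLargeProductFree c G) := by
  have hsimple : ¬ ∃ c : ℝ, 0 < c ∧ ∀ (G : Type u) [Group G],
      IsFiniteSimpleNonabelian G → HasLargeProductFree c G := by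
    rintro ⟨c, hc, h⟩
    obtain ⟨N, hN⟩ := exists_card_bound_of_hasLargeProductFree.{u} hc
    obtain ⟨G, _, hG, hlt⟩ := exists_isFiniteSimpleNonabelian_card_gt.{u} N
    exact (hN G hG (h G hG)).not_gt hlt
  refine ⟨fun c hc => ?_, hsimple, ?_⟩
  · obtain ⟨N, hN⟩ := exists_card_bound_of_hasLargeProductFree.{u} hc
    exact (finite_groupIsoClass_image_of_card_le N).subset
      (Set.image_mono fun G hG => ⟨hG.1.1, hN G hG.1 hG.2⟩)
  · rintro ⟨c, hc, h⟩
    refine hsimple ⟨c, hc, fun G _ ⟨_, hs, _⟩ => ?_⟩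
    have := hs.toNontrivial
    exact h G
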